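/- Let $(K,v)$ be a (Krull-)valued field of arbitrary rank with value group $\Gamma_v$, let $\bar v$ be an extension of $v$ to an algebraic closure $\overline K$ of $K$, let $w$ be an extension of $v$ to $K(X)$, and let $\overline w$ be a common extension of $w$ and $\bar v$ to $\overline K(X)$. **Key polynomials and augmentations.** Let $u$ be a valuation on $K[X]$. For $f,g\in K[X]$ write $f\sim_u g$ if $u(f-g)>u(f)=u(g)$, and $f\mid_u g$ if $g\sim_u fh$ for some $h\in K[X]$. A monic polynomial $\phi$ is a key polynomial for $u$ if $\phi\mid_u hq$ implies $\phi\mid_u h$ or $\phi\mid_u q$, and $\phi\mid_u h$ implies $\deg h\ge\deg\phi$. For a key polynomial $\phi$ for $u$ and $\gamma>u(\phi)$ in an ordered abelian group containing the value group of $u$, the augmentation $[u;\phi,\gamma]$ is the map $f\mapsto\min_i\{u(f_i)+i\gamma\}$, where $f=\sum_i f_i\phi^i$ with $\deg f_i<\deg\phi$. **Optimal MacLane chains.** Let $w_{-\infty}(f)=(-\deg f, v(a_n))\in\mathbb Z\times\Gamma_v$ (lexicographic order), where $a_n$ is the leading coefficient of $f\neq0$, and embed $\Gamma_v\otimes\mathbb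 Q$ in $\mathbb Z\times(\Gamma_v\otimes\mathbb Q)$ by $\gamma\mapsto(0,\gamma)$. An optimal MacLane chain of $w$ is a chain $$w_{-\infty}\xrightarrow{\phi_0,\gamma_0}w_0\xrightarrow{\phi_1,\gamma_1}w_1\to\cdots\to w_{r-1}\xrightarrow{\phi_r,\gamma_r}w_r=w$$ with $r\ge 0$ and $\gamma_0,\dots,\gamma_r\in\Gamma_v\otimes\mathbb Q$, in which $w_0=[w_{-\infty};\phi_0,\gamma_0]$ and $w_i=[w_{i-1};\phi_i,\gamma_i]$ for $1\le i\le r$ (each $\phi_i$ being a key polynomial for the preceding valuation, with $\gamma_i$ greater than the value of $\phi_i$ under it), and such that $m_i=\deg\phi_i$ satisfy $1=m_0\mid m_1\mid\cdots\mid m_r$ and $m_0<m_1<\cdots<m_r$. **Abstract key polynomials.** For $f\in K[X]$ put $\delta(f)=\max\{\overline w(X-\alpha)\mid \alpha\in\overline K,\ f(\alpha)=0\}$ if $f$ is nonconstant, and $\delta(f)=-\infty$ if $f$ is constant. A monic $Q\in K[X]$ is an abstract key polynomial (ABKP) for $w$ if $\delta(f)<\delta(Q)$ for all $f\in K[X]$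 with $\deg f<\deg Q$. For nonconstant $Q$, the truncation is $w_Q(f)=\min_i w(f_iQ^i)$, where $f=\sum_i f_iQ^i$ with $\deg f_i<\deg Q$. Let $\psi(Q)$ be the set of monic $f$ with $w_Q(f)<w(f)$ whose degree is the least among all $f\in K[X]$ with $w_Q(f)<w(f)$. A family $\{Q_i\}_{i\in\Delta}$ of ABKPs for $w$, indexed by a totally ordered set $\Delta$, is a complete set of ABKPs for $w$ if $\delta(Q_i)\ne\delta(Q_j)$ for $i\neq j$, if it is well-ordered by $Q_i<Q_j\iff\delta(Q_i)<\delta(Q_j)$, this order being that of $\Delta$, and if for every $f\in K[X]$ there is $i\in\Delta$ with $w_{Q_i}(f)=w(f)$. **Theorem.** Suppose that $w$ has an optimal MacLane chain as above. Then $\{\phi_i\}_{0\le i\le r}$, indexed by $\Delta=\{0<1<\cdots<r\}$, is a complete set of ABKPs for $w$. Moreover $w_i=w_{\phi_i}$ for $0\le i\le r$, and $\phi_i\in\psi(\phi_{i-1})$ for $1\le i\le r$. -/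

import Mathlib

open Polynomial

noncomputable section

namespace MacLane

/-! ### Expansions, augmentations and truncations -/

/-- The `i`-th coefficient `f_i` of the `q`-expansion `f = ∑ f_i q ^ i`, `deg f_i < deg q`,
of a polynomial `f` with respect to a nonconstant polynomial `q`. -/
def expCoeff {K : Type*} [Field K] (q : K[X]) : ℕ → K[X] → K[X]
  | 0, f => f % q
  | i + 1, f => expCoeff q i (f / q)

/-- The map `f ↦ min_i (w (f_i) + i γ)`, where `f = ∑ f_i φ ^ i` is the `φ`-expansion.
The indices `i > deg f` are left out: there `f_i = 0`. -/
def augment {K G : Type*} [Field K] [AddCommGroup G] [LinearOrder G]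
    (w : K[X] → WithTop G) (φ : K[X]) (γ : G) (f : K[X]) : WithTop G :=
  (Finset.range (f.natDegree + 1)).inf fun i => w (expCoeff φ i f) + ((i • γ : G) : WithTop G)

/-- The `q`-truncation `w_q (f) = min_i w (f_i q ^ i)`, where `f = ∑ f_i q ^ i` is the
`q`-expansion. -/
def truncation {K G : Type*} [Field K] [LinearOrder G]
    (w : K[X] → WithTop G) (q : K[X]) (f : K[X]) : WithTop G :=
  (Finset.range (f.natDegree + 1)).inf fun i => w (expCoeff q i f * q ^ i)

/-! ### Key polynomials -/

/-- `f ∼_w g`. -/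
def WEquiv {K G : Type*} [Field K] [LinearOrder G] (w : K[X] → WithTop G) (f g : K[X]) : Prop :=
  w f < w (f - g) ∧ w f = w g

/-- `f ∣_w g`. -/
def WDvd {K G : Type*} [Field K] [LinearOrder G] (w : K[X] → WithTop G) (f g : K[X]) : Prop :=
  ∃ h : K[X], WEquiv w g (f * h)

/-- `f` is `w`-irreducible. -/
def WIrreducible {K G : Type*} [Field K] [LinearOrder G] (w : K[X] → WithTop G)
    (f : K[X]) : Prop :=
  ∀ h q : K[X], WDvd w f (h * q) → WDvd w f h ∨ WDvd w f q

/-- `f` is `w`-minimal. -/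
def WMinimal {K G : Type*} [Field K] [LinearOrder G] (w : K[X] → WithTop G) (f : K[X]) : Prop :=
  ∀ h : K[X], WDvd w f h → f.degree ≤ h.degree

/-- Key polynomials for `w`. -/
structure IsKeyPolynomial {K G : Type*} [Field K] [LinearOrder G] (w : K[X] → WithTop G)
    (φ : K[X]) : Prop where
  monic : φ.Monic
  irreducible : WIrreducible w φ
  minimal : WMinimal w φ

/-- `w'` is the ordinary augmentation `[w; φ, γ]` of `w`: the polynomial `φ` is a key polynomial
for `w`, and `γ > w (φ)`. -/
structure IsAugmentation {K G : Type*} [Field K] [AddCommGroup G] [LinearOrder G]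
    (w : K[X] → WithTop G) (φ : K[X]) (γ : G) (w' : K[X] → WithTop G) : Prop where
  key : IsKeyPolynomial w φ
  lt : w φ < (γ : WithTop G)
  eq : w' = augment w φ γ

/-! ### Optimal MacLane chains -/

/-- The minimal extension `w_{-∞} (f) = (- deg f, v (a_n))`, `a_n` the leading coefficient of `f`,
with values in `ℤ × Γ`, ordered lexicographically; `w_{-∞} (0) = ∞`, since `v (0) = ∞`. -/
def minimalExtension {K Γ : Type*} [Field K] [AddCommGroup Γ] [LinearOrder Γ]
    [IsOrderedAddMonoid Γ] (v : AddValuation K (WithTop Γ)) (f : K[X]) : WithTop (ℤ ×ₗ Γ) :=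
  (v f.leadingCoeff).map fun a => toLex (-(f.natDegree : ℤ), a)

/-- The embedding `γ ↦ (0, γ)`, `∞ ↦ ∞`. -/
def embed {Γ : Type*} (γ : WithTop Γ) : WithTop (ℤ ×ₗ Γ) :=
  γ.map fun a => toLex ((0 : ℤ), a)

/-- `γ` lies in `Γ_v ⊗ ℚ`: some positive multiple of `γ` is a value of `v`. -/
def IsCommensurable {K Γ : Type*} [Field K] [AddCommGroup Γ] [LinearOrder Γ]
    [IsOrderedAddMonoid Γ] (v : AddValuation K (WithTop Γ)) (γ : Γ) : Prop :=
  ∃ n : ℕ, 0 < n ∧ ∃ a : K, v a = ((n • γ : Γ) : WithTop Γ)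

/-- The restriction of `w` to `K[X]`. -/
def onPoly {K Γ : Type*} [Field K] [AddCommGroup Γ] [LinearOrder Γ] [IsOrderedAddMonoid Γ]
    (w : AddValuation (RatFunc K) (WithTop Γ)) (f : K[X]) : WithTop Γ :=
  w (algebraMap K[X] (RatFunc K) f)

/-- `w_{-∞} → W_0 → ⋯ → W_r = w` is an optimal MacLane chain of `w`, with key polynomials
`φ_0, …, φ_r` and values `γ_0, …, γ_r`. All members of the chain take values in
`(ℤ ×ₗ Γ) ∪ {∞}`, in which `Γ` is embedded by `γ ↦ (0, γ)`. -/
structure IsOptimalMacLaneChain {K Γ : Type*} [Field K] [AddCommGroup Γ] [LinearOrder Γ]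
    [IsOrderedAddMonoid Γ] (v : AddValuation K (WithTop Γ))
    (w : AddValuation (RatFunc K) (WithTop Γ)) (r : ℕ) (φ : Fin (r + 1) → K[X])
    (γ : Fin (r + 1) → Γ) (W : Fin (r + 1) → K[X] → WithTop (ℤ ×ₗ Γ)) : Prop where
  commensurable : ∀ i, IsCommensurable v (γ i)
  zero : IsAugmentation (minimalExtension v) (φ 0) (toLex ((0 : ℤ), γ 0)) (W 0)
  succ : ∀ i : Fin r,
    IsAugmentation (W i.castSucc) (φ i.succ) (toLex ((0 : ℤ), γ i.succ)) (W i.succ)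
  last : ∀ f : K[X], W (Fin.last r) f = embed (onPoly w f)
  natDegree_zero : (φ 0).natDegree = 1
  natDegree_dvd : ∀ i : Fin r, (φ i.castSucc).natDegree ∣ (φ i.succ).natDegree
  natDegree_lt : ∀ i : Fin r, (φ i.castSucc).natDegree < (φ i.succ).natDegree

/-! ### Abstract key polynomials -/

/-- The inclusion `K(X) → L(X)`. -/
def ratFuncMap (K L : Type*) [Field K] [Field L] [Algebra K L] : RatFunc K →+* RatFunc L :=
  RatFunc.mapRingHom (Polynomial.mapRingHom (algebraMap K L))
    (nonZeroDivisors_le_comap_nonZeroDivisors_of_injective _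
      (Polynomial.map_injective _ (algebraMap K L).injective))

/-- `v'` is an extension of `v` to `L`, `w` is an extension of `v` to `K(X)`, and `w'` is a common
extension of `w` and `v'` to `L(X)`. -/
structure IsCommonExtension {K L Γ : Type*} [Field K] [Field L] [Algebra K L]
    [AddCommGroup Γ] [LinearOrder Γ] [IsOrderedAddMonoid Γ]
    (v : AddValuation K (WithTop Γ)) (v' : AddValuation L (WithTop Γ))
    (w : AddValuation (RatFunc K) (WithTop Γ)) (w' : AddValuation (RatFunc L) (WithTop Γ)) :
    Prop where
  base : ∀ a : K, v' (algebraMap K L a) = v a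
  ext : ∀ a : K, w (RatFunc.C a) = v a
  ext_base : ∀ a : L, w' (RatFunc.C a) = v' a
  ext_ext : ∀ f : RatFunc K, w' (ratFuncMap K L f) = w f

open Classical in
/-- The optimal value `δ (f)`: the maximum of `w' (X - α)` over the roots `α` of `f` in `L`.
It is `⊥ = -∞` for constant polynomials (also for `f = 0`). -/
def optimalValue {K L Γ : Type*} [Field K] [Field L] [Algebra K L]
    [AddCommGroup Γ] [LinearOrder Γ] [IsOrderedAddMonoid Γ]
    (w' : AddValuation (RatFunc L) (WithTop Γ)) (f : K[X]) : WithBot (WithTop Γ) :=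
  ((f.aroots L).toFinset.image fun α => w' (RatFunc.X - RatFunc.C α)).max

/-- Abstract key polynomials. -/
structure IsABKP {K L Γ : Type*} [Field K] [Field L] [Algebra K L]
    [AddCommGroup Γ] [LinearOrder Γ] [IsOrderedAddMonoid Γ]
    (w' : AddValuation (RatFunc L) (WithTop Γ)) (Q : K[X]) : Prop where
  monic : Q.Monic
  lt : ∀ f : K[X], f.degree < Q.degree → optimalValue w' f < optimalValue w' Q

/-- `α (Q)`, the least degree of a polynomial `f` with `w_Q (f) < w (f)` (`∞` if there is none). -/
def alpha {K G : Type*} [Field K] [LinearOrder G] (w : K[X] → WithTop G) (Q : K[X]) : ℕ∞ :=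
  ⨅ (f : K[X]) (_ : truncation w Q f < w f), (f.natDegree : ℕ∞)

/-- `ψ (Q)`. -/
def psi {K G : Type*} [Field K] [LinearOrder G] (w : K[X] → WithTop G) (Q : K[X]) : Set K[X] :=
  {f | f.Monic ∧ truncation w Q f < w f ∧ (f.natDegree : ℕ∞) = alpha w Q}

/-- `{Q_i}`, `i ∈ ι`, is a complete set of abstract key polynomials for `w`; the optimal values
are taken with respect to the common extension `w'`. -/
structure IsCompleteSet {K L Γ : Type*} [Field K] [Field L] [Algebra K L]
    [AddCommGroup Γ] [LinearOrder Γ] [IsOrderedAddMonoid Γ] {ι : Type*} [LinearOrder ι]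
    (w : AddValuation (RatFunc K) (WithTop Γ)) (w' : AddValuation (RatFunc L) (WithTop Γ))
    (Q : ι → K[X]) : Prop where
  abkp : ∀ i, IsABKP w' (Q i)
  ne : ∀ i j, i ≠ j → optimalValue w' (Q i) ≠ optimalValue w' (Q j)
  lt_iff : ∀ i j, optimalValue w' (Q i) < optimalValue w' (Q j) ↔ i < j
  wellOrder : IsWellOrder ι fun i j => optimalValue w' (Q i) < optimalValue w' (Q j)
  complete : ∀ f : K[X], ∃ i, truncation (onPoly w) (Q i) f = onPoly w f

end MacLane

end

/-! The heart of the matter is that truncation at an abstract key polynomial is a Gauss valuation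
seen from `L`. Let `β` be a root of `Q` with `w' (X - β) = δ (Q) = δ`, and let `u (F)` be the
minimum of `v' (F_j) + j δ` over the coefficients `F_j` of `F` expanded in powers of `X - β`.
Splitting `f` into linear factors over `L` gives `w (f) = u (f)` as soon as `δ (f) ≤ δ`; if `δ (f) <
δ`, the minimum is already attained at index `0`. The constant term of `Q` at `β` vanishes, so every
multiple of `Q` first attains its minimum at a positive index. Hence in `f = f % Q + Q * (f / Q)`
the two summands cannot cancel in `u`, and induction gives `w_Q = u` on `K[X]`
(`IsABKP.exists_isGaussOrder`). So `w_Q` is a valuation, and it agrees with `w` on all `f` with `δ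
(f) ≤ δ (Q)`.

This lets the key polynomial property climb the chain (`IsABKP.of_truncation_lt`): if `w_Q (φ) < w
(φ)` while `w_Q = w` below the degree of `φ`, then `φ` is again an abstract key polynomial. A
counterexample of least degree, made monic, is an abstract key polynomial `g` with `w_g (φ) = w
(φ)`; but `w_g ≤ w_Q`, a contradiction.

On the side of the chain, strict growth of degrees means that later augmentations do not change
values in degree at most `deg φ_i`. Therefore `γ_i = w (φ_i)`, the coefficients of a `φ_i`-expansion
already have their final values, and `w_i = w_{φ_i}`. The inequality `γ_i > w_{i-1} (φ_i)` then
becomes the hypothesis of the climbing step, which starts from the linear polynomial `φ_0`. -/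

namespace MacLane

/-! ### Initial terms with respect to a Gauss valuation -/

/-- `m` is the minimum of `v (F_j) + j δ` over the coefficients `F_j` of `F`, and `k` is the
smallest index at which it is attained. -/
structure IsGaussOrder {L Γ : Type*} [Field L] [AddCommGroup Γ] [LinearOrder Γ]
    [IsOrderedAddMonoid Γ] (v : AddValuation L (WithTop Γ)) (δ : Γ) (F : L[X]) (k : ℕ) (m : Γ) :
    Prop where
  eq : v (F.coeff k) = ((m - k • δ : Γ) : WithTop Γ)
  le : ∀ j, ((m - j • δ : Γ) : WithTop Γ) ≤ v (F.coeff j)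
  lt : ∀ j < k, ((m - j • δ : Γ) : WithTop Γ) < v (F.coeff j)

namespace IsGaussOrder

variable {L Γ : Type*} [Field L] [AddCommGroup Γ] [LinearOrder Γ] [IsOrderedAddMonoid Γ]
  {v : AddValuation L (WithTop Γ)} {δ : Γ} {F G : L[X]} {k l : ℕ} {m n : Γ}

theorem value_le (hF : IsGaussOrder v δ F k m) (hG : IsGaussOrder v δ F l n) : m ≤ n := by
  have h := hF.le l
  rw [hG.eq, WithTop.coe_le_coe] at h
  exact (sub_le_sub_iff_right _).1 h

theorem value_unique (hF : IsGaussOrder v δ F k m) (hG : IsGaussOrder v δ F l n) : m = n :=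
  le_antisymm (hF.value_le hG) (hG.value_le hF)

theorem const {c : L} (hc : v c = m) : IsGaussOrder v δ (C c) 0 m where
  eq := by simpa using hc
  le j := by
    rcases j with _ | j
    · simp [hc]
    · simp
  lt j hj := absurd hj (Nat.not_lt_zero j)

theorem X_add_C_of_le {c : L} (hc : v c = m) (hm : m ≤ δ) : IsGaussOrder v δ (X + C c) 0 m where
  eq := by simpa using hc
  le j := by
    rcases j with _ | _ | j
    · simp [hc]
    · have h : ((m - (0 + 1) • δ : Γ) : WithTop Γ) ≤ ((0 : Γ) : WithTop Γ) :=
        WithTop.coe_le_coe.2 (by simpa using hm)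
      simpa using h
    · simp [coeff_X]
  lt j hj := absurd hj (Nat.not_lt_zero j)

theorem X_add_C_of_lt {c : L} (hc : δ < v c) : IsGaussOrder v δ (X + C c) 1 δ where
  eq := by simp
  le j := by
    rcases j with _ | _ | j
    · simpa using hc.le
    · simp
    · simp [coeff_X]
  lt j hj := by
    obtain rfl : j = 0 := by omega
    simpa using hc

/-- Gauss's lemma: if `a + b ≤ k + l` and `(a, b) ≠ (k, l)`, then `a < k` or `b < l`, so a single
product dominates the coefficient of index `k + l`, and none reaches the minimum at a smaller index.
-/
theorem mul (hF : IsGaussOrder v δ F k m) (hG : IsGaussOrder v δ G l n) :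
    IsGaussOrder v δ (F * G) (k + l) (m + n) := by
  have split (a b : ℕ) : ((m + n - (a + b) • δ : Γ) : WithTop Γ) =
      ((m - a • δ : Γ) : WithTop Γ) + ((n - b • δ : Γ) : WithTop Γ) := by
    rw [← WithTop.coe_add, add_smul]; congr 1; abel
  have strict (a b : ℕ) (h : a < k ∨ b < l) :
      ((m + n - (a + b) • δ : Γ) : WithTop Γ) < v (F.coeff a * G.coeff b) := by
    rw [AddValuation.map_mul, split]
    rcases h with h | h
    · exact WithTop.add_lt_add_of_lt_of_le WithTop.coe_ne_top (hF.lt a h) (hG.le b)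
    · exact WithTop.add_lt_add_of_le_of_lt WithTop.coe_ne_top (hF.le a) (hG.lt b h)
  refine ⟨?_, fun j => ?_, fun j hj => ?_⟩
  · have hkl : (k, l) ∈ Finset.HasAntidiagonal.antidiagonal (k + l) := by simp
    rw [coeff_mul, ← Finset.add_sum_erase _ _ hkl]
    have h0 : v (F.coeff k * G.coeff l) = ((m + n - (k + l) • δ : Γ) : WithTop Γ) := by
      rw [AddValuation.map_mul, hF.eq, hG.eq, split]
    rw [AddValuation.map_add_eq_of_lt_left, h0]
    rw [h0]
    refine AddValuation.map_lt_sum v WithTop.coe_ne_top fun x hx => ?_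
    obtain ⟨a, b⟩ := x
    simp only [Finset.mem_erase, ne_eq, Prod.mk.injEq, Finset.HasAntidiagonal.mem_antidiagonal] at hx
    rw [← hx.2]
    exact strict a b (by omega)
  · rw [coeff_mul]
    refine AddValuation.map_le_sum v fun x hx => ?_
    rw [← Finset.HasAntidiagonal.mem_antidiagonal.1 hx, split, AddValuation.map_mul]
    exact add_le_add (hF.le _) (hG.le _)
  · rw [coeff_mul]
    refine AddValuation.map_lt_sum v WithTop.coe_ne_top fun x hx => ?_
    have := Finset.HasAntidiagonal.mem_antidiagonal.1 hx
    rw [← this]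
    exact strict _ _ (by omega)

/-- Even in the tie `m = n` nothing cancels at index `0`, because there `G` lies strictly above its
minimum. -/
theorem add_of_le (hF : IsGaussOrder v δ F 0 m) (hG : IsGaussOrder v δ G k n) (hk : 0 < k)
    (h : m ≤ n) : IsGaussOrder v δ (F + G) 0 m where
  eq := by
    have := hG.lt 0 hk
    rw [coeff_add, AddValuation.map_add_eq_of_lt_left, hF.eq]
    rw [hF.eq]
    exact lt_of_le_of_lt (WithTop.coe_le_coe.2 (sub_le_sub_right h _)) this
  le j := by
    rw [coeff_add]
    exact AddValuation.map_le_add v (hF.le j)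
      ((WithTop.coe_le_coe.2 (sub_le_sub_right h _)).trans (hG.le j))
  lt j hj := absurd hj (Nat.not_lt_zero j)

theorem add_of_lt (hF : IsGaussOrder v δ F l m) (hG : IsGaussOrder v δ G k n)
    (h : n < m) : IsGaussOrder v δ (F + G) k n := by
  have key (j : ℕ) : ((n - j • δ : Γ) : WithTop Γ) < v (F.coeff j) :=
    lt_of_lt_of_le (WithTop.coe_lt_coe.2 (sub_lt_sub_right h _)) (hF.le j)
  refine ⟨?_, fun j => ?_, fun j hj => ?_⟩
  · rw [coeff_add, AddValuation.map_add_eq_of_lt_right, hG.eq]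
    rw [hG.eq]
    exact key k
  · rw [coeff_add]
    exact AddValuation.map_le_add v (key j).le (hG.le j)
  · rw [coeff_add]
    exact AddValuation.map_lt_add v (key j) (hG.lt j hj)

theorem pos_of_coeff_zero (hF : IsGaussOrder v δ F k m) (h : F.coeff 0 = 0) : 0 < k := by
  rcases k with _ | k
  · have := hF.eq
    simp [h] at this
  · omega

end IsGaussOrder

/-! ### The restriction of a valuation to polynomials -/

section OnPoly

variable {K Γ : Type*} [Field K] [AddCommGroup Γ] [LinearOrder Γ] [IsOrderedAddMonoid Γ]
  (w : AddValuation (RatFunc K) (WithTop Γ))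

theorem onPoly_zero : onPoly w 0 = ⊤ := by simp [onPoly]

theorem onPoly_mul (f g : K[X]) : onPoly w (f * g) = onPoly w f + onPoly w g := by
  simp [onPoly]

theorem onPoly_pow (f : K[X]) (n : ℕ) : onPoly w (f ^ n) = n • onPoly w f := by
  simp [onPoly]

theorem exists_onPoly_eq {f : K[X]} (hf : f ≠ 0) : ∃ m : Γ, onPoly w f = m := by
  have : onPoly w f ≠ ⊤ := by
    rw [onPoly, AddValuation.ne_top_iff]
    simpa using hf
  exact ⟨_, (WithTop.coe_untop _ this).symm⟩

end OnPoly

/-! ### Expansions and truncations -/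

section Expansion

variable {K G : Type*} [Field K] [AddCommGroup G] [LinearOrder G]

theorem expCoeff_zero_right (q : K[X]) (i : ℕ) : expCoeff q i 0 = 0 := by
  induction i with
  | zero => simp [expCoeff]
  | succ i ih => simpa [expCoeff] using ih

theorem natDegree_lt_of_degree_lt {f q : K[X]} (hq : 0 < q.natDegree) (h : f.degree < q.degree) :
    f.natDegree < q.natDegree := by
  by_cases hf : f = 0
  · simpa [hf] using hq
  · exact natDegree_lt_natDegree hf h

theorem natDegree_div_lt {f q : K[X]} (hq : 0 < q.natDegree) (hf : f / q ≠ 0) :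
    (f / q).natDegree < f.natDegree :=
  natDegree_lt_natDegree hf (degree_div_lt (by rintro rfl; simp at hf)
    (natDegree_pos_iff_degree_pos.1 hq))

theorem expCoeff_eq_zero {q : K[X]} (hq : 0 < q.natDegree) (i : ℕ) (f : K[X])
    (h : f.natDegree < i) : expCoeff q i f = 0 := by
  induction i generalizing f with
  | zero => omega
  | succ i ih =>
    rw [expCoeff]
    by_cases hf : f / q = 0
    · rw [hf, expCoeff_zero_right]
    · exact ih _ (by have := natDegree_div_lt hq hf; omega)

theorem natDegree_expCoeff_lt {q : K[X]} (hq : 0 < q.natDegree) (i : ℕ) (f : K[X]) :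
    (expCoeff q i f).natDegree < q.natDegree := by
  induction i generalizing f with
  | zero => exact natDegree_lt_of_degree_lt hq (degree_mod_lt f (by rintro rfl; simp at hq))
  | succ i ih => exact ih _

theorem truncation_eq_inf {Γ : Type*} [AddCommGroup Γ] [LinearOrder Γ] [IsOrderedAddMonoid Γ]
    (w : AddValuation (RatFunc K) (WithTop Γ)) {q : K[X]} (hq : 0 < q.natDegree) (f : K[X])
    {N : ℕ} (hN : f.natDegree < N) :
    truncation (onPoly w) q f =
      (Finset.range N).inf fun i => onPoly w (expCoeff q i f * q ^ i) := by
  refine le_antisymm (Finset.le_inf fun i _ => ?_)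
    (Finset.inf_mono (Finset.range_subset_range.2 hN))
  by_cases hi : i < f.natDegree + 1
  · exact Finset.inf_le (Finset.mem_range.2 hi)
  · rw [expCoeff_eq_zero hq i f (by omega), zero_mul, onPoly_zero]
    exact le_top

theorem truncation_zero {Γ : Type*} [AddCommGroup Γ] [LinearOrder Γ] [IsOrderedAddMonoid Γ]
    (w : AddValuation (RatFunc K) (WithTop Γ)) (q : K[X]) : truncation (onPoly w) q 0 = ⊤ := by
  simp [truncation, expCoeff, onPoly_zero]

/-- The recursion on which the inductions over `f / q` below rest. -/
theorem truncation_eq_min {Γ : Type*} [AddCommGroup Γ] [LinearOrder Γ] [IsOrderedAddMonoid Γ]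
    (w : AddValuation (RatFunc K) (WithTop Γ)) {q : K[X]} (hq : 0 < q.natDegree) (f : K[X]) :
    truncation (onPoly w) q f =
      min (onPoly w (f % q)) (onPoly w q + truncation (onPoly w) q (f / q)) := by
  have hdeg : (f / q).natDegree < f.natDegree + 1 := by
    by_cases hf : f / q = 0
    · simp [hf]
    · have := natDegree_div_lt hq hf; omega
  -- One superfluous index is added, so that removing the term `i = 0` leaves a range long enough
  -- for `f / q`.
  rw [truncation_eq_inf w hq f (N := f.natDegree + 1 + 1) (by omega),
    truncation_eq_inf w hq (f / q) hdeg, Finset.range_add_one', Finset.inf_insert,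
    Finset.inf_map]
  congr 1
  · simp [expCoeff]
  · rw [Finset.apply_inf_eq_inf_comp (onPoly w q + ·) (fun a b => min_add_add_left _ a b |>.symm)
      (by simp)]
    refine Finset.inf_congr rfl fun i _ => ?_
    change onPoly w (expCoeff q i (f / q) * q ^ (i + 1)) = onPoly w q + onPoly w _
    rw [← onPoly_mul]
    congr 1
    ring

end Expansion

/-! ### Gauss valuations centred at optimizing roots -/

section Center

variable {L Γ : Type*} [Field L] [AddCommGroup Γ] [LinearOrder Γ] [IsOrderedAddMonoid Γ]
  {v' : AddValuation L (WithTop Γ)} {w' : AddValuation (RatFunc L) (WithTop Γ)} {β : L} {δ : Γ}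

/-- Write `X - ρ = (X - β) + (β - ρ)`. The value of `β - ρ` is that of a difference of two linear
polynomials, hence equals `w' (X - ρ)` when the latter is below `δ`, and is at least `δ` when it
equals `δ`. Index `1` occurs only in the second case. -/
theorem exists_isGaussOrder_X_sub_C (hv : ∀ a : L, w' (RatFunc.C a) = v' a)
    (hβ : onPoly w' (X - C β) = δ) {ρ : L} (hρ : onPoly w' (X - C ρ) ≤ δ) :
    ∃ (k : ℕ) (m : Γ), onPoly w' (X - C ρ) = m ∧ IsGaussOrder v' δ (taylor β (X - C ρ)) k m ∧
      (onPoly w' (X - C ρ) < δ → k = 0) := by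
  obtain ⟨m, hm⟩ := exists_onPoly_eq w' (X_sub_C_ne_zero ρ)
  have ht : taylor β (X - C ρ) = X + C (β - ρ) := by
    simp [taylor_X, taylor_C, sub_eq_add_neg, add_assoc]
  have hc : v' (β - ρ) =
      w' (algebraMap L[X] (RatFunc L) (X - C ρ) - algebraMap L[X] (RatFunc L) (X - C β)) := by
    rw [← hv]
    congr 1
    simp
  unfold onPoly at hβ hρ hm ⊢
  rw [ht]
  rw [hm] at hρ ⊢
  rcases hρ.lt_or_eq with h | h
  · refine ⟨0, m, rfl, .X_add_C_of_le ?_ (WithTop.coe_le_coe.1 hρ), fun _ => rfl⟩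
    rw [hc, AddValuation.map_sub_eq_of_lt_left, hm]
    rw [hm, hβ]
    exact h
  · have hle : (δ : WithTop Γ) ≤ v' (β - ρ) := by
      rw [hc]
      exact AddValuation.map_le_sub _ (by rw [hm, h]) (by rw [hβ])
    obtain rfl : m = δ := WithTop.coe_injective h
    rcases hle.lt_or_eq with h' | h'
    · exact ⟨1, m, rfl, .X_add_C_of_lt h', fun h => absurd h (lt_irrefl _)⟩
    · exact ⟨0, m, rfl, .X_add_C_of_le h'.symm le_rfl, fun _ => rfl⟩

theorem exists_isGaussOrder_prod (hv : ∀ a : L, w' (RatFunc.C a) = v' a)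
    (hβ : onPoly w' (X - C β) = δ) (s : Multiset L)
    (hs : ∀ ρ ∈ s, onPoly w' (X - C ρ) ≤ δ) :
    ∃ (k : ℕ) (m : Γ), onPoly w' (s.map fun ρ => X - C ρ).prod = m ∧
      IsGaussOrder v' δ (taylor β (s.map fun ρ => X - C ρ).prod) k m ∧
      ((∀ ρ ∈ s, onPoly w' (X - C ρ) < δ) → k = 0) := by
  induction s using Multiset.induction_on with
  | empty =>
    refine ⟨0, 0, by simp [onPoly], ?_, fun _ => rfl⟩
    simpa using IsGaussOrder.const (v := v') (δ := δ) (c := 1) (m := 0) (by simp)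
  | cons ρ s ih =>
    obtain ⟨k, m, h1, h2, h3⟩ := ih fun x hx => hs x (Multiset.mem_cons_of_mem hx)
    obtain ⟨l, n, e1, e2, e3⟩ :=
      exists_isGaussOrder_X_sub_C hv hβ (hs ρ (Multiset.mem_cons_self ρ s))
    refine ⟨l + k, n + m, ?_, ?_, fun h => ?_⟩
    · rw [Multiset.map_cons, Multiset.prod_cons, onPoly_mul, h1, e1, WithTop.coe_add]
    · rw [Multiset.map_cons, Multiset.prod_cons, taylor_mul]
      exact e2.mul h2
    · rw [e3 (h ρ (Multiset.mem_cons_self ρ s)),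
        h3 fun x hx => h x (Multiset.mem_cons_of_mem hx)]

theorem exists_isGaussOrder_taylor [IsAlgClosed L] (hv : ∀ a : L, w' (RatFunc.C a) = v' a)
    (hβ : onPoly w' (X - C β) = δ) {F : L[X]} (hF : F ≠ 0)
    (hs : ∀ ρ ∈ F.roots, onPoly w' (X - C ρ) ≤ δ) :
    ∃ (k : ℕ) (m : Γ), onPoly w' F = m ∧ IsGaussOrder v' δ (taylor β F) k m ∧
      ((∀ ρ ∈ F.roots, onPoly w' (X - C ρ) < δ) → k = 0) := by
  obtain ⟨k, m, h1, h2, h3⟩ := exists_isGaussOrder_prod hv hβ F.roots hs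
  obtain ⟨n, hn⟩ := exists_onPoly_eq w' (C_ne_zero.2 (leadingCoeff_ne_zero.2 hF))
  have hn' : v' F.leadingCoeff = n := by
    rw [← hv, ← hn]
    simp [onPoly]
  have hp := (IsAlgClosed.splits F).eq_prod_roots
  refine ⟨0 + k, n + m, ?_, ?_, fun h => by rw [h3 h]⟩
  · rw [hp, onPoly_mul, hn, h1, WithTop.coe_add]
  · rw [hp, taylor_mul, taylor_C]
    exact (IsGaussOrder.const hn').mul h2

end Center

/-! ### Optimal values -/

section OptimalValue

variable {K L Γ : Type*} [Field K] [Field L] [Algebra K L]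
  [AddCommGroup Γ] [LinearOrder Γ] [IsOrderedAddMonoid Γ]

theorem onPoly_X_sub_C (w' : AddValuation (RatFunc L) (WithTop Γ)) (α : L) :
    onPoly w' (X - C α) = w' (RatFunc.X - RatFunc.C α) := by
  simp [onPoly]

theorem le_optimalValue (w' : AddValuation (RatFunc L) (WithTop Γ)) {f : K[X]} {α : L}
    (hα : α ∈ f.aroots L) : ((onPoly w' (X - C α) : WithTop Γ) : WithBot (WithTop Γ)) ≤ optimalValue w' f := by
  classical
  rw [onPoly_X_sub_C, optimalValue]
  refine Finset.le_max (Finset.mem_image.2 ⟨α, ?_, rfl⟩)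
  simpa using hα

theorem exists_optimalValue_eq [IsAlgClosed L] (w' : AddValuation (RatFunc L) (WithTop Γ))
    {f : K[X]} (hf : 0 < f.natDegree) :
    ∃ β ∈ f.aroots L, ∃ δ : Γ, onPoly w' (X - C β) = δ ∧
      optimalValue w' f = ((δ : WithTop Γ) : WithBot (WithTop Γ)) := by
  classical
  have hf0 : f ≠ 0 := by rintro rfl; simp at hf
  obtain ⟨α, hα⟩ := IsAlgClosed.exists_aeval_eq_zero L f (natDegree_pos_iff_degree_pos.1 hf).ne'
  have hα' : α ∈ f.aroots L := mem_aroots.2 ⟨hf0, hα⟩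
  obtain ⟨d, hd⟩ := Finset.max_of_mem (Finset.mem_image_of_mem
    (fun α => w' (RatFunc.X - RatFunc.C α)) (Multiset.mem_toFinset.2 hα'))
  obtain ⟨β, hβ, hβd⟩ := Finset.mem_image.1 (Finset.mem_of_max hd)
  obtain ⟨δ, hδ⟩ := exists_onPoly_eq w' (X_sub_C_ne_zero β)
  refine ⟨β, Multiset.mem_toFinset.1 hβ, δ, hδ, ?_⟩
  rw [← hδ, onPoly_X_sub_C, hβd]
  exact hd

theorem optimalValue_of_natDegree_eq_zero (w' : AddValuation (RatFunc L) (WithTop Γ)) {f : K[X]}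
    (hf : f.natDegree = 0) : optimalValue w' f = ⊥ := by
  rw [eq_C_of_natDegree_eq_zero hf]
  simp [optimalValue]

theorem natDegree_pos_of_optimalValue_ne_bot {w' : AddValuation (RatFunc L) (WithTop Γ)}
    {f : K[X]} (hf : optimalValue w' f ≠ ⊥) : 0 < f.natDegree :=
  Nat.pos_of_ne_zero fun h => hf (optimalValue_of_natDegree_eq_zero w' h)

theorem optimalValue_C_mul (w' : AddValuation (RatFunc L) (WithTop Γ)) {a : K} (ha : a ≠ 0)
    (f : K[X]) : optimalValue w' (C a * f) = optimalValue w' f := by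
  rw [optimalValue, optimalValue, aroots_C_mul f ha]

theorem IsABKP.natDegree_pos {w' : AddValuation (RatFunc L) (WithTop Γ)} {Q : K[X]}
    (hQ : IsABKP w' Q) : 0 < Q.natDegree :=
  natDegree_pos_of_optimalValue_ne_bot
    (hQ.lt 0 (by simpa [bot_lt_iff_ne_bot] using hQ.monic.ne_zero)).ne_bot

theorem isABKP_of_natDegree_eq_one [IsAlgClosed L] (w' : AddValuation (RatFunc L) (WithTop Γ))
    {Q : K[X]} (hQ : Q.Monic) (h1 : Q.natDegree = 1) : IsABKP w' Q where
  monic := hQ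
  lt f hf := by
    have hf0 : f.natDegree = 0 := by
      have := natDegree_lt_of_degree_lt (by omega) hf
      omega
    obtain ⟨β, -, δ, -, h⟩ := exists_optimalValue_eq w' (f := Q) (by omega)
    rw [optimalValue_of_natDegree_eq_zero w' hf0, h]
    exact WithBot.bot_lt_coe _

end OptimalValue

/-! ### Truncations at abstract key polynomials -/

section Truncation

variable {K L Γ : Type*} [Field K] [Field L] [Algebra K L]
  [AddCommGroup Γ] [LinearOrder Γ] [IsOrderedAddMonoid Γ]
  {v : AddValuation K (WithTop Γ)} {v' : AddValuation L (WithTop Γ)}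
  {w : AddValuation (RatFunc K) (WithTop Γ)} {w' : AddValuation (RatFunc L) (WithTop Γ)}

theorem IsCommonExtension.onPoly_map (hext : IsCommonExtension v v' w w') (f : K[X]) :
    onPoly w' (f.map (algebraMap K L)) = onPoly w f := by
  rw [onPoly, onPoly, ← hext.ext_ext]
  congr 1
  have h := RatFunc.map_apply_div (Polynomial.mapRingHom (algebraMap K L))
    (nonZeroDivisors_le_comap_nonZeroDivisors_of_injective _
      (Polynomial.map_injective _ (algebraMap K L).injective)) f 1
  simp only [map_one, div_one, coe_mapRingHom] at h
  rw [ratFuncMap, RatFunc.coe_mapRingHom_eq_coe_map, h]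

variable [IsAlgClosed L]

theorem IsCommonExtension.exists_isGaussOrder (hext : IsCommonExtension v v' w w') {β : L} {δ : Γ}
    (hβ : onPoly w' (X - C β) = δ) {f : K[X]} (hf : f ≠ 0)
    (hs : optimalValue w' f ≤ ((δ : WithTop Γ) : WithBot (WithTop Γ))) :
    ∃ (k : ℕ) (m : Γ), onPoly w f = m ∧
      IsGaussOrder v' δ (taylor β (f.map (algebraMap K L))) k m ∧
      (optimalValue w' f < ((δ : WithTop Γ) : WithBot (WithTop Γ)) → k = 0) := by
  obtain ⟨k, m, h1, h2, h3⟩ := exists_isGaussOrder_taylor hext.ext_base hβ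
    ((Polynomial.map_ne_zero_iff (algebraMap K L).injective).2 hf)
    fun ρ hρ => WithBot.coe_le_coe.1 ((le_optimalValue w' hρ).trans hs)
  exact ⟨k, m, by rw [← hext.onPoly_map, h1], h2,
    fun h => h3 fun ρ hρ => WithBot.coe_lt_coe.1 ((le_optimalValue w' hρ).trans_lt h)⟩

/-- Identifies `w_Q` with the Gauss valuation at `β`: in each Euclidean division the remainder has
index `0` and the multiple of `Q` a positive index, so the value of the sum is the minimum of the
two values. -/
theorem IsABKP.exists_isGaussOrder {Q : K[X]} (hQ : IsABKP w' Q)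
    (hext : IsCommonExtension v v' w w') {β : L} {δ : Γ} (hβQ : β ∈ Q.aroots L)
    (hβ : onPoly w' (X - C β) = δ)
    (hδ : optimalValue w' Q = ((δ : WithTop Γ) : WithBot (WithTop Γ))) {f : K[X]} (hf : f ≠ 0) :
    ∃ (k : ℕ) (m : Γ), truncation (onPoly w) Q f = m ∧
      IsGaussOrder v' δ (taylor β (f.map (algebraMap K L))) k m := by
  have hpos := hQ.natDegree_pos
  obtain ⟨kQ, mQ, hmQ, hGQ, -⟩ := hext.exists_isGaussOrder hβ hQ.monic.ne_zero hδ.le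
  have hkQ : 0 < kQ := hGQ.pos_of_coeff_zero <| by
    rw [taylor_coeff_zero, eval_map_algebraMap]
    exact (mem_aroots.1 hβQ).2
  induction h : f.natDegree using Nat.strong_induction_on generalizing f with
  | _ d ih =>
    subst h
    have hmod : f % Q ≠ 0 → ∃ m : Γ, onPoly w (f % Q) = m ∧
        IsGaussOrder v' δ (taylor β ((f % Q).map (algebraMap K L))) 0 m := fun h0 => by
      have hlt := hQ.lt _ (degree_mod_lt f hQ.monic.ne_zero)
      rw [hδ] at hlt
      obtain ⟨k, m, h1, h2, h3⟩ := hext.exists_isGaussOrder hβ h0 hlt.le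
      obtain rfl := h3 hlt
      exact ⟨m, h1, h2⟩
    have hdiv : f / Q ≠ 0 → ∃ (k : ℕ) (m : Γ), 0 < k ∧
        onPoly w Q + truncation (onPoly w) Q (f / Q) = m ∧
        IsGaussOrder v' δ (taylor β ((Q * (f / Q)).map (algebraMap K L))) k m := fun h0 => by
      obtain ⟨k, m, h1, h2⟩ := ih _ (natDegree_div_lt hpos h0) h0 rfl
      refine ⟨kQ + k, mQ + m, by omega, by rw [h1, hmQ, WithTop.coe_add], ?_⟩
      rw [Polynomial.map_mul, taylor_mul]
      exact hGQ.mul h2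
    have hsum := EuclideanDomain.mod_add_div f Q
    have ht := truncation_eq_min w hpos f
    by_cases h0 : f / Q = 0
    · rw [h0, mul_zero, add_zero] at hsum
      obtain ⟨m, h1, h2⟩ := hmod (by rwa [hsum])
      rw [h0, truncation_zero, h1] at ht
      rw [hsum] at h2
      exact ⟨0, m, by simpa using ht, h2⟩
    obtain ⟨k, n, hk, e1, e2⟩ := hdiv h0
    rw [e1] at ht
    by_cases h1 : f % Q = 0
    · rw [h1, onPoly_zero] at ht
      rw [h1, zero_add] at hsum
      rw [hsum] at e2
      exact ⟨k, n, by simpa using ht, e2⟩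
    obtain ⟨m, g1, g2⟩ := hmod h1
    rw [g1] at ht
    -- The final `hsum` restores `f` inside the truncation; only its Taylor expansion stays split.
    rw [← hsum, Polynomial.map_add, map_add, hsum]
    rcases le_or_gt m n with hmn | hmn
    · exact ⟨0, m, by rw [ht, min_eq_left (WithTop.coe_le_coe.2 hmn)], g2.add_of_le e2 hk hmn⟩
    · exact ⟨k, n, by rw [ht, min_eq_right (WithTop.coe_le_coe.2 hmn.le)], g2.add_of_lt e2 hmn⟩

theorem IsABKP.truncation_eq_of_optimalValue_le {Q : K[X]} (hQ : IsABKP w' Q)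
    (hext : IsCommonExtension v v' w w') {f : K[X]}
    (hf : optimalValue w' f ≤ optimalValue w' Q) :
    truncation (onPoly w) Q f = onPoly w f := by
  by_cases hf0 : f = 0
  · rw [hf0, truncation_zero, onPoly_zero]
  obtain ⟨β, hβQ, δ, hβ, hδ⟩ := exists_optimalValue_eq w' hQ.natDegree_pos
  obtain ⟨k, m, h1, h2⟩ := hQ.exists_isGaussOrder hext hβQ hβ hδ hf0
  rw [hδ] at hf
  obtain ⟨l, n, e1, e2, -⟩ := hext.exists_isGaussOrder hβ hf0 hf
  rw [h1, e1, h2.value_unique e2]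

theorem IsABKP.truncation_mul {Q : K[X]} (hQ : IsABKP w' Q)
    (hext : IsCommonExtension v v' w w') (f g : K[X]) :
    truncation (onPoly w) Q (f * g) =
      truncation (onPoly w) Q f + truncation (onPoly w) Q g := by
  by_cases hf : f = 0
  · simp [hf, truncation_zero]
  by_cases hg : g = 0
  · simp [hg, truncation_zero]
  obtain ⟨β, hβQ, δ, hβ, hδ⟩ := exists_optimalValue_eq w' hQ.natDegree_pos
  obtain ⟨k, m, h1, h2⟩ := hQ.exists_isGaussOrder hext hβQ hβ hδ hf
  obtain ⟨l, n, e1, e2⟩ := hQ.exists_isGaussOrder hext hβQ hβ hδ hg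
  obtain ⟨i, p, g1, g2⟩ := hQ.exists_isGaussOrder hext hβQ hβ hδ (mul_ne_zero hf hg)
  rw [Polynomial.map_mul, taylor_mul] at g2
  rw [h1, e1, g1, g2.value_unique (h2.mul e2), WithTop.coe_add]

theorem IsABKP.le_truncation_add {Q : K[X]} (hQ : IsABKP w' Q)
    (hext : IsCommonExtension v v' w w') (f g : K[X]) :
    min (truncation (onPoly w) Q f) (truncation (onPoly w) Q g) ≤
      truncation (onPoly w) Q (f + g) := by
  by_cases hf : f = 0
  · simp [hf]
  by_cases hg : g = 0
  · simp [hg]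
  by_cases hfg : f + g = 0
  · simp [hfg, truncation_zero]
  obtain ⟨β, hβQ, δ, hβ, hδ⟩ := exists_optimalValue_eq w' hQ.natDegree_pos
  obtain ⟨k, m, h1, h2⟩ := hQ.exists_isGaussOrder hext hβQ hβ hδ hf
  obtain ⟨l, n, e1, e2⟩ := hQ.exists_isGaussOrder hext hβQ hβ hδ hg
  obtain ⟨i, p, g1, g2⟩ := hQ.exists_isGaussOrder hext hβQ hβ hδ hfg
  -- It suffices to compare coefficients at the index `i` where `f + g` attains its minimum.
  have key := AddValuation.map_add v' ((taylor β (f.map (algebraMap K L))).coeff i)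
    ((taylor β (g.map (algebraMap K L))).coeff i)
  rw [← coeff_add, ← map_add, ← Polynomial.map_add, g2.eq] at key
  have h := (min_le_min (h2.le i) (e2.le i)).trans key
  simp only [min_le_iff, WithTop.coe_le_coe, sub_le_sub_iff_right] at h
  rw [h1, e1, g1, min_le_iff]
  simpa only [WithTop.coe_le_coe] using h

/-- The remainders modulo `g`, and `g` itself, have the same value under `w_Q` as under `w`. Since
`w_Q` is a valuation, its value on the `g`-expansion is at least the minimum over the terms. -/
theorem IsABKP.truncation_le_truncation {Q g : K[X]} (hQ : IsABKP w' Q)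
    (hext : IsCommonExtension v v' w w') (hg : 0 < g.natDegree)
    (hQg : ∀ f : K[X], f.natDegree ≤ g.natDegree → truncation (onPoly w) Q f = onPoly w f)
    (f : K[X]) : truncation (onPoly w) g f ≤ truncation (onPoly w) Q f := by
  induction h : f.natDegree using Nat.strong_induction_on generalizing f with
  | _ d ih =>
    subst h
    have hle : truncation (onPoly w) g (f / g) ≤ truncation (onPoly w) Q (f / g) := by
      by_cases hf : f / g = 0
      · simp [hf, truncation_zero]
      · exact ih _ (natDegree_div_lt hg hf) _ rfl
    have hmod : (f % g).natDegree < g.natDegree := natDegree_expCoeff_lt hg 0 f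
    calc truncation (onPoly w) g f
        = min (onPoly w (f % g)) (onPoly w g + truncation (onPoly w) g (f / g)) :=
          truncation_eq_min w hg f
      _ ≤ min (truncation (onPoly w) Q (f % g)) (truncation (onPoly w) Q (g * (f / g))) := by
          rw [hQ.truncation_mul hext, hQg _ hmod.le, hQg _ le_rfl]
          gcongr
      _ ≤ truncation (onPoly w) Q (f % g + g * (f / g)) := hQ.le_truncation_add hext _ _
      _ = truncation (onPoly w) Q f := by rw [EuclideanDomain.mod_add_div]

/-- The passage from one key polynomial of the chain to the next, by a counterexample of least
degree. -/
theorem IsABKP.of_truncation_lt {Q φ : K[X]} (hQ : IsABKP w' Q)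
    (hext : IsCommonExtension v v' w w') (hφ : φ.Monic) (hdeg : 0 < φ.natDegree)
    (hlt : truncation (onPoly w) Q φ < onPoly w φ)
    (heq : ∀ f : K[X], f.natDegree < φ.natDegree → truncation (onPoly w) Q f = onPoly w f) :
    IsABKP w' φ := by
  refine ⟨hφ, ?_⟩
  by_contra! hcon
  obtain ⟨f, ⟨hfdeg, hfφ⟩, hmin⟩ := WellFounded.has_min
    (measure (Polynomial.natDegree : K[X] → ℕ)).wf
    {f : K[X] | f.degree < φ.degree ∧ optimalValue w' φ ≤ optimalValue w' f} hcon
  obtain ⟨α, hα, ε, hε, hεφ⟩ := exists_optimalValue_eq w' hdeg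
  have hfpos : 0 < f.natDegree := natDegree_pos_of_optimalValue_ne_bot <| by
    intro h
    rw [h, hεφ] at hfφ
    exact absurd hfφ (by simp)
  have hf0 : f ≠ 0 := by rintro rfl; simp at hfpos
  have hlc : f.leadingCoeff⁻¹ ≠ 0 := inv_ne_zero (leadingCoeff_ne_zero.2 hf0)
  set g : K[X] := C f.leadingCoeff⁻¹ * f with hg_def
  have hgdeg : g.degree = f.degree := degree_C_mul hlc
  have hgnat : g.natDegree = f.natDegree := natDegree_C_mul hlc
  have hgopt : optimalValue w' g = optimalValue w' f := optimalValue_C_mul w' hlc f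
  -- By minimality of `f`, any `h` of smaller degree has `δ (h) < δ (φ) ≤ δ (g)`.
  have hg : IsABKP w' g := by
    refine ⟨by rw [hg_def, mul_comm]; exact monic_mul_leadingCoeff_inv hf0, fun h hh => ?_⟩
    rw [hgopt]
    refine lt_of_lt_of_le (not_le.1 fun hle => ?_) hfφ
    rw [hgdeg] at hh
    refine hmin h ⟨hh.trans hfdeg, hle⟩ ?_
    exact natDegree_lt_of_degree_lt hfpos hh
  have hgφ : g.natDegree < φ.natDegree := by
    rw [hgnat]
    exact natDegree_lt_of_degree_lt hdeg hfdeg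
  have h1 := hg.truncation_eq_of_optimalValue_le hext (hfφ.trans hgopt.ge)
  have h2 := hQ.truncation_le_truncation hext hg.natDegree_pos
    (fun p hp => heq p (hp.trans_lt hgφ)) φ
  rw [h1] at h2
  exact absurd h2 (not_le.2 hlt)

end Truncation

/-! ### Augmentations -/

section Augment

variable {K G : Type*} [Field K] [AddCommGroup G] [LinearOrder G]

theorem augment_of_lt {U : K[X] → WithTop G} (hU : U 0 = ⊤) {q f : K[X]} (γ : G)
    (h : f.natDegree < q.natDegree) : augment U q γ f = U f := by
  have hq : q ≠ 0 := by rintro rfl; simp at h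
  have hd : f.degree < q.degree := degree_lt_degree h
  refine le_antisymm ?_ (Finset.le_inf fun i _ => ?_)
  · refine (Finset.inf_le (Finset.mem_range.2 f.natDegree.succ_pos)).trans_eq ?_
    simp [expCoeff, (mod_eq_self_iff hq).2 hd]
  · rcases i with _ | i
    · simp [expCoeff, (mod_eq_self_iff hq).2 hd]
    · simp [expCoeff, (Polynomial.div_eq_zero_iff hq).2 hd, expCoeff_zero_right, hU]

theorem augment_self {U : K[X] → WithTop G} (hU : U 0 = ⊤) (hU1 : U 1 = 0) {q : K[X]}
    (hq : 0 < q.natDegree) (γ : G) : augment U q γ q = γ := by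
  have hq0 : q ≠ 0 := by rintro rfl; simp at hq
  have hd : (1 : K[X]).degree < q.degree := degree_lt_degree (by simpa using hq)
  have h1 : U (expCoeff q 1 q) = 0 := by
    simp [expCoeff, EuclideanDomain.div_self hq0, (mod_eq_self_iff hq0).2 hd, hU1]
  refine le_antisymm ?_ (Finset.le_inf fun i _ => ?_)
  · refine (Finset.inf_le (Finset.mem_range.2 (by omega : 1 < q.natDegree + 1))).trans_eq ?_
    rw [h1, one_smul, zero_add]
  · rcases i with _ | _ | i
    · simp [expCoeff, EuclideanDomain.mod_self, hU]
    · rw [zero_add, h1, zero_add, one_smul]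
    · simp [expCoeff, EuclideanDomain.div_self hq0, (Polynomial.div_eq_zero_iff hq0).2 hd,
        expCoeff_zero_right, hU]

end Augment

section Embed

theorem embed_strictMono {Γ : Type*} [LinearOrder Γ] :
    StrictMono (embed : WithTop Γ → WithTop (ℤ ×ₗ Γ)) :=
  StrictMono.withTop_map fun a b h => by simpa [Prod.Lex.toLex_lt_toLex] using h

theorem embed_add_coe {Γ : Type*} [AddCommGroup Γ] (a : WithTop Γ) (b : Γ) :
    embed (a + (b : WithTop Γ)) = embed a + ((toLex ((0 : ℤ), b) : ℤ ×ₗ Γ) : WithTop (ℤ ×ₗ Γ)) := by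
  induction a with
  | top => rfl
  | coe a => rfl

variable {Γ : Type*} [AddCommGroup Γ] [LinearOrder Γ] [IsOrderedAddMonoid Γ]

/-- Only values of `U` below the degree of `q` enter the augmentation, so agreement with `w` there
suffices for a comparison term by term. -/
theorem augment_eq_embed_truncation {K : Type*} [Field K]
    (w : AddValuation (RatFunc K) (WithTop Γ)) {U : K[X] → WithTop (ℤ ×ₗ Γ)} {q : K[X]} {γ : Γ}
    (hq : 0 < q.natDegree) (hγ : onPoly w q = γ)
    (hU : ∀ h : K[X], h.natDegree < q.natDegree → U h = embed (onPoly w h)) (f : K[X]) :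
    augment U q (toLex ((0 : ℤ), γ)) f = embed (truncation (onPoly w) q f) := by
  rw [truncation, Finset.apply_inf_eq_inf_comp embed (fun a b => embed_strictMono.monotone.map_min)
    rfl, augment]
  refine Finset.inf_congr rfl fun i _ => ?_
  rw [Function.comp, onPoly_mul, onPoly_pow, hγ, ← WithTop.coe_nsmul, embed_add_coe,
    hU _ (natDegree_expCoeff_lt hq i f)]
  congr 2

end Embed

/-! ### Optimal MacLane chains -/

namespace IsOptimalMacLaneChain

variable {K Γ : Type*} [Field K] [AddCommGroup Γ] [LinearOrder Γ]
  [IsOrderedAddMonoid Γ] {v : AddValuation K (WithTop Γ)}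
  {w : AddValuation (RatFunc K) (WithTop Γ)} {r : ℕ} {φ : Fin (r + 1) → K[X]}
  {γ : Fin (r + 1) → Γ} {W : Fin (r + 1) → K[X] → WithTop (ℤ ×ₗ Γ)}

theorem natDegree_strictMono (hc : IsOptimalMacLaneChain v w r φ γ W) :
    StrictMono fun i => (φ i).natDegree :=
  Fin.strictMono_iff_lt_succ.2 hc.natDegree_lt

theorem natDegree_pos (hc : IsOptimalMacLaneChain v w r φ γ W) (i : Fin (r + 1)) :
    0 < (φ i).natDegree := by
  have := hc.natDegree_strictMono.monotone (Fin.zero_le i)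
  have h0 := hc.natDegree_zero
  omega

theorem monic (hc : IsOptimalMacLaneChain v w r φ γ W) (i : Fin (r + 1)) : (φ i).Monic := by
  induction i using Fin.cases with
  | zero => exact hc.zero.key.monic
  | succ i => exact (hc.succ i).key.monic

theorem minimalExtension_of_natDegree_eq_zero (v : AddValuation K (WithTop Γ)) {f : K[X]}
    (hf : f.natDegree = 0) : minimalExtension v f = embed (v (f.coeff 0)) := by
  simp [minimalExtension, embed, leadingCoeff, hf]

theorem minimalExtension_zero (v : AddValuation K (WithTop Γ)) : minimalExtension v 0 = ⊤ := by
  simp [minimalExtension]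

theorem minimalExtension_one (v : AddValuation K (WithTop Γ)) : minimalExtension v 1 = 0 := by
  rw [minimalExtension_of_natDegree_eq_zero v natDegree_one, coeff_one_zero, v.map_one]
  rfl

theorem apply_zero (hc : IsOptimalMacLaneChain v w r φ γ W) (i : Fin (r + 1)) : W i 0 = ⊤ := by
  induction i using Fin.induction with
  | zero =>
    have h0 := minimalExtension_zero v
    rw [hc.zero.eq, augment_of_lt h0 _ (by simpa using hc.natDegree_pos 0), h0]
  | succ i ih =>
    rw [(hc.succ i).eq, augment_of_lt ih _ (by simpa using hc.natDegree_pos i.succ), ih]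

theorem apply_one (hc : IsOptimalMacLaneChain v w r φ γ W) (i : Fin (r + 1)) : W i 1 = 0 := by
  induction i using Fin.induction with
  | zero =>
    rw [hc.zero.eq, augment_of_lt (minimalExtension_zero v) _ (by simpa using hc.natDegree_pos 0),
      minimalExtension_one]
  | succ i ih =>
    rw [(hc.succ i).eq,
      augment_of_lt (hc.apply_zero _) _ (by simpa using hc.natDegree_pos i.succ), ih]

/-- Each later key polynomial has degree greater than `deg φ_i`, so `f` is its own zeroth
coefficient in the corresponding expansion. -/
theorem apply_eq_apply (hc : IsOptimalMacLaneChain v w r φ γ W) {i j : Fin (r + 1)} (hij : i ≤ j)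
    {f : K[X]} (hf : f.natDegree ≤ (φ i).natDegree) : W j f = W i f := by
  induction j using Fin.induction with
  | zero => rw [Fin.le_zero_iff.1 hij]
  | succ j ih =>
    rcases hij.eq_or_lt with rfl | hij
    · rfl
    have hij' : i ≤ j.castSucc := Fin.le_castSucc_iff.2 hij
    have := hc.natDegree_strictMono hij
    rw [(hc.succ j).eq, augment_of_lt (hc.apply_zero _) _ (hf.trans_lt this), ih hij']

theorem apply_eq_embed (hc : IsOptimalMacLaneChain v w r φ γ W) {i : Fin (r + 1)} {f : K[X]}
    (hf : f.natDegree ≤ (φ i).natDegree) : W i f = embed (onPoly w f) := by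
  rw [← hc.last, hc.apply_eq_apply (Fin.le_last i) hf]

theorem apply_castSucc_eq_embed (hc : IsOptimalMacLaneChain v w r φ γ W) {i : Fin r} {f : K[X]}
    (hf : f.natDegree < (φ i.succ).natDegree) : W i.castSucc f = embed (onPoly w f) := by
  rw [← hc.apply_eq_embed hf.le, (hc.succ i).eq, augment_of_lt (hc.apply_zero _) _ hf]

theorem apply_self (hc : IsOptimalMacLaneChain v w r φ γ W) (i : Fin (r + 1)) :
    W i (φ i) = ((toLex ((0 : ℤ), γ i) : ℤ ×ₗ Γ) : WithTop (ℤ ×ₗ Γ)) := by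
  induction i using Fin.cases with
  | zero =>
    rw [hc.zero.eq]
    exact augment_self (minimalExtension_zero v) (minimalExtension_one v) (hc.natDegree_pos 0) _
  | succ i =>
    rw [(hc.succ i).eq]
    exact augment_self (hc.apply_zero _) (hc.apply_one _) (hc.natDegree_pos i.succ) _

theorem onPoly_eq (hc : IsOptimalMacLaneChain v w r φ γ W) (i : Fin (r + 1)) :
    onPoly w (φ i) = γ i :=
  embed_strictMono.injective (by rw [← hc.apply_eq_embed le_rfl, hc.apply_self]; rfl)

theorem apply_eq_embed_truncation (hc : IsOptimalMacLaneChain v w r φ γ W)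
    (hw : ∀ a : K, w (RatFunc.C a) = v a) (i : Fin (r + 1)) (f : K[X]) :
    W i f = embed (truncation (onPoly w) (φ i) f) := by
  induction i using Fin.cases with
  | zero =>
    rw [hc.zero.eq]
    refine augment_eq_embed_truncation w (hc.natDegree_pos 0) (hc.onPoly_eq 0) (fun h hh => ?_) f
    -- Since `φ_0` is linear, its expansions have constant coefficients, where `w_{-∞}` is `v` and
    -- therefore `w`.
    have h0 : h.natDegree = 0 := by have := hc.natDegree_zero; omega
    rw [minimalExtension_of_natDegree_eq_zero v h0, ← hw, onPoly]
    conv_rhs => rw [eq_C_of_natDegree_eq_zero h0]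
    simp
  | succ i =>
    rw [(hc.succ i).eq]
    exact augment_eq_embed_truncation w (hc.natDegree_pos i.succ) (hc.onPoly_eq i.succ)
      (fun h hh => hc.apply_castSucc_eq_embed hh) f

theorem truncation_eq_onPoly (hc : IsOptimalMacLaneChain v w r φ γ W)
    (hw : ∀ a : K, w (RatFunc.C a) = v a) {i : Fin r} {f : K[X]}
    (hf : f.natDegree < (φ i.succ).natDegree) :
    truncation (onPoly w) (φ i.castSucc) f = onPoly w f :=
  embed_strictMono.injective <| by
    rw [← hc.apply_eq_embed_truncation hw, hc.apply_castSucc_eq_embed hf]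

theorem truncation_lt_onPoly (hc : IsOptimalMacLaneChain v w r φ γ W)
    (hw : ∀ a : K, w (RatFunc.C a) = v a) (i : Fin r) :
    truncation (onPoly w) (φ i.castSucc) (φ i.succ) < onPoly w (φ i.succ) :=
  embed_strictMono.lt_iff_lt.1 <| by
    rw [← hc.apply_eq_embed_truncation hw, hc.onPoly_eq]
    exact (hc.succ i).lt

theorem mem_psi (hc : IsOptimalMacLaneChain v w r φ γ W)
    (hw : ∀ a : K, w (RatFunc.C a) = v a) (i : Fin r) :
    φ i.succ ∈ psi (onPoly w) (φ i.castSucc) := by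
  refine ⟨hc.monic _, hc.truncation_lt_onPoly hw i, le_antisymm ?_ ?_⟩
  · refine le_iInf₂ fun f hf => ?_
    by_contra! h
    exact hf.ne (hc.truncation_eq_onPoly hw (by exact_mod_cast h))
  · exact iInf₂_le (φ i.succ) (hc.truncation_lt_onPoly hw i)

theorem isABKP {L : Type*} [Field L] [Algebra K L] [IsAlgClosed L]
    {v' : AddValuation L (WithTop Γ)} {w' : AddValuation (RatFunc L) (WithTop Γ)}
    (hc : IsOptimalMacLaneChain v w r φ γ W) (hext : IsCommonExtension v v' w w')
    (i : Fin (r + 1)) : IsABKP w' (φ i) := by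
  induction i using Fin.induction with
  | zero => exact isABKP_of_natDegree_eq_one w' (hc.monic 0) hc.natDegree_zero
  | succ i ih =>
    exact ih.of_truncation_lt hext (hc.monic _) (hc.natDegree_pos _)
      (hc.truncation_lt_onPoly hext.ext i) fun f hf => hc.truncation_eq_onPoly hext.ext hf

theorem isCompleteSet {L : Type*} [Field L] [Algebra K L] [IsAlgClosed L]
    {v' : AddValuation L (WithTop Γ)} {w' : AddValuation (RatFunc L) (WithTop Γ)}
    (hc : IsOptimalMacLaneChain v w r φ γ W) (hext : IsCommonExtension v v' w w') :
    IsCompleteSet w w' φ := by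
  have hmono : StrictMono fun i => optimalValue w' (φ i) := fun i j hij =>
    (hc.isABKP hext j).lt _ (degree_lt_degree (hc.natDegree_strictMono hij))
  refine ⟨hc.isABKP hext, fun i j hij => hmono.injective.ne hij, fun i j => hmono.lt_iff_lt, ?_,
    fun f => ⟨Fin.last r, embed_strictMono.injective ?_⟩⟩
  · have h : (fun i j => optimalValue w' (φ i) < optimalValue w' (φ j)) = (· < ·) := by
      funext i j
      exact propext hmono.lt_iff_lt
    rw [h]
    infer_instance
  -- The last index serves every `f`, because `w_{φ_r} = w_r = w`.
  · rw [← hc.apply_eq_embed_truncation hext.ext, hc.last]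

end IsOptimalMacLaneChain

end MacLane

theorem mainTheorem6 {K L Γ : Type*} [Field K] [Field L] [Algebra K L] [IsAlgClosure K L]
    [AddCommGroup Γ] [LinearOrder Γ] [IsOrderedAddMonoid Γ]
    (v : AddValuation K (WithTop Γ)) (v' : AddValuation L (WithTop Γ))
    (w : AddValuation (RatFunc K) (WithTop Γ)) (w' : AddValuation (RatFunc L) (WithTop Γ))
    (hext : MacLane.IsCommonExtension v v' w w')
    (r : ℕ) (φ : Fin (r + 1) → K[X]) (γ : Fin (r + 1) → Γ)
    (W : Fin (r + 1) → K[X] → WithTop (ℤ ×ₗ Γ))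
    (hchain : MacLane.IsOptimalMacLaneChain v w r φ γ W) :
    MacLane.IsCompleteSet w w' φ ∧
    (∀ (i : Fin (r + 1)) (f : K[X]),
      W i f = MacLane.embed (MacLane.truncation (MacLane.onPoly w) (φ i) f)) ∧
    (∀ i : Fin r, φ i.succ ∈ MacLane.psi (MacLane.onPoly w) (φ i.castSucc)) := by
  have : IsAlgClosed L := IsAlgClosure.isAlgClosed K
  exact ⟨hchain.isCompleteSet hext, hchain.apply_eq_embed_truncation hext.ext,
    hchain.mem_psi hext.ext⟩
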